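/- Let $n\ge 1$ be an integer and let $V$ be the $(n+1)\times(n+1)$ matrix with $V_{ij}=1$ if $i=n+1$, or if $j\ge2$ and $i+j\le n+2$, and $V_{ij}=0$ otherwise. Let $\Delta\subset\mathbb{R}^n$ be the $n$-simplex whose vertices $v_1,\dots,v_{n+1}$ are obtained by deleting the last coordinate (which is $1$) of the columns of $V$. For $a\in\{0,1\}$ let $A_a$ be the $(n+1)\times(n+1)$ matrix whose entries are all $0$, except for those in position $(1+a,1)$, $(1,n+1)$, $(2,n+1)$, and $(j+1,j)$ for $2\le j\le n$, which are $1$; let $B_a$ be obtained from $A_a$ by replacing the two $1$'s in the last column by $1/2$. Put $M_a=VA_a^{-1}V^{-1}$ and $T_a=VB_a^{-1}V^{-1}$. **Lemma.** Let $s>0$, let $a_0,\dots,a_{s-1}\in\{0,1\}$, and let $M_*=M_{a_{s-1}}\cdots M_{a_0}$ and $T_*=T_{a_{s-1}}\cdots T_{a_0}$. Then: (i) there exists a unique point $q=(\alpha_1,\dots,\alpha_n)\in\Delta$ such that $(\alpha_1,\dots,\alpha_n,1)^{tr}$ is a right eigenvector of $M_*$ whose corresponding eigenvalue $\xi$ is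 a positive real number; moreover $\mathbb{Q}(\xi)=\mathbb{Q}(\alpha_1,\dots,\alpha_n)$; (ii) there exists a unique point $q=(\alpha_1,\dots,\alpha_n)\in\Delta$ such that $(\alpha_1,\dots,\alpha_n,1)^{tr}$ is a right eigenvector of $T_*$ whose corresponding eigenvalue $\xi$ is positive; moreover $\xi=1$ and $\alpha_1,\dots,\alpha_n\in\mathbb{Q}$. -/

import Mathlib

namespace Monkemeyer

noncomputable section

/-- The matrix `V`, whose columns are the primitive projective coordinates of the vertices of `Δ`.
With 1-based indices, the entry in position `ij` is `1` if `i = n + 1`, or if `j ≥ 2` and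
`i + j ≤ n + 2`; all other entries are `0`. (Here indices are 0-based.) -/
def V (n : ℕ) : Matrix (Fin (n + 1)) (Fin (n + 1)) ℝ :=
  Matrix.of fun i j =>
    if i.val = n ∨ (1 ≤ j.val ∧ i.val + j.val ≤ n) then 1 else 0

/-- The matrices `A_0` and `A_1`. With 1-based indices, the nonzero entries of `A_a` are equal to
`1` and are in position `(1,1)` for `a = 0`, in position `(2,1)` for `a = 1`, and for both values
of `a` in positions `(1,n+1)`, `(2,n+1)` and `(j+1,j)` for `2 ≤ j ≤ n`.
(Here indices are 0-based.) -/
def A (n : ℕ) (a : Fin 2) : Matrix (Fin (n + 1)) (Fin (n + 1)) ℝ :=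
  Matrix.of fun i j =>
    if (i.val = a.val ∧ j.val = 0)
      ∨ (i.val = 0 ∧ j.val = n)
      ∨ (i.val = 1 ∧ j.val = n)
      ∨ (1 ≤ j.val ∧ i.val = j.val + 1) then 1 else 0

/-- `B_a` is `A_a` with the two `1`'s in the last column replaced by `1/2`. -/
def B (n : ℕ) (a : Fin 2) : Matrix (Fin (n + 1)) (Fin (n + 1)) ℝ :=
  Matrix.of fun i j => if j = Fin.last n then A n a i j / 2 else A n a i j

/-- `M_a = V A_a⁻¹ V⁻¹`. -/
def M (n : ℕ) (a : Fin 2) : Matrix (Fin (n + 1)) (Fin (n + 1)) ℝ :=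
  V n * (A n a)⁻¹ * (V n)⁻¹

/-- `T_a = V B_a⁻¹ V⁻¹`. -/
def T (n : ℕ) (a : Fin 2) : Matrix (Fin (n + 1)) (Fin (n + 1)) ℝ :=
  V n * (B n a)⁻¹ * (V n)⁻¹

/-- The product `N_{a_{s-1}} ⋯ N_{a_1} N_{a_0}`, in this order. -/
def wordProd {n s : ℕ} (N : Fin 2 → Matrix (Fin (n + 1)) (Fin (n + 1)) ℝ) (a : Fin s → Fin 2) :
    Matrix (Fin (n + 1)) (Fin (n + 1)) ℝ :=
  (List.ofFn fun t => N (a t)).reverse.prod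

/-- The `j`-th vertex of `Δ`: the projection to `ℝⁿ` of the `j`-th column of `V`. -/
def vertex (n : ℕ) (j : Fin (n + 1)) : Fin n → ℝ :=
  fun i => V n i.castSucc j / V n (Fin.last n) j

/-- The simplex `Δ` in `ℝⁿ`. -/
def Delta (n : ℕ) : Set (Fin n → ℝ) :=
  convexHull ℝ (Set.range (vertex n))

/-- The column vector `(α₁, …, αₙ, 1)` of a point `(α₁, …, αₙ)` of `ℝⁿ`. -/
def lift {n : ℕ} (q : Fin n → ℝ) : Fin (n + 1) → ℝ :=
  Fin.snoc (α := fun _ => ℝ) q 1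

/-- `(α₁, …, αₙ, 1)` is a right eigenvector of `N` with eigenvalue `ξ`. -/
def IsEigenpoint {n : ℕ} (N : Matrix (Fin (n + 1)) (Fin (n + 1)) ℝ) (ξ : ℝ) (q : Fin n → ℝ) :
    Prop :=
  Module.End.HasEigenvector (Matrix.toLin' N) ξ (lift q)

end

end Monkemeyer

/-!
In barycentric coordinates `w` on `Δ`, with `V w = (q, 1)`, the point `q` is an eigenpoint of the
product with eigenvalue `ξ` exactly when `P w = ξ⁻¹ w`, where `P = C_{a_0} ⋯ C_{a_{s-1}}` and `C_a`
is `A_a` or `B_a`, that is, `A_a` with last column scaled by `c = 1` or `c = 1 / 2`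
(`isEigenpoint_iff`). So the statement is one of Perron-Frobenius type for the nonnegative matrix
`P`. This matrix need not be irreducible, and has transient coordinates in general.

The classes of `P` are visible from a scalar recursion (`IsRun`). Each `C_a` shifts the middle
coordinates, so an orbit is described by its first entry `u t` and its last entry `y t`, with
`u (t + 1) = [a = 0] u t + c y t` and `y (t + n) = [a = 1] u t + c y t`, where `a` is the letter used
at time `t`. Hence `y` splits into residue classes modulo `n`, and only a class in which the letter
`1` occurs, a live class, is fed by `u`. Two facts carry the proof.

* Every nonzero nonnegative orbit eventually becomes positive at `u` and on all live classes
  (`IsRun.eventually_pos`), so these form the unique final class `K` of `P`, and `P` is primitive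
  on it (`isFinalClass_of_orbit`).
* A nonnegative eigenvector with positive eigenvalue is supported on `K`
  (`IsRun.y_eq_zero_of_not_live`). The reason is that the sum of the entries changes by
  `(2 c - 1) y t ≥ 0` at each step, whereas a class that is not live is only multiplied by powers of
  `c ≤ 1`.

For such matrices, an eigenvector in the standard simplex exists by the Collatz-Wielandt maximum
over the face spanned by `K`, and it is unique (`IsFinalClass.exists_eigenvector`,
`IsFinalClass.eq_of_eigenvector`). It is even the only real solution of `P w = ξ⁻¹ w` that is
supported on `K` and has entries of sum `1` (`IsFinalClass.eq_of_supp`). A unique solution of a linear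
system over `ℚ(ξ)` has entries in `ℚ(ξ)` (`mem_of_forall_retraction`), and conversely `ξ⁻¹` is the sum
of the entries of `P w`; this gives `ℚ(ξ) = ℚ(q)`. For `B_a` the matrices are column-stochastic, so
`ξ = 1` and `q` is rational.
-/

namespace Monkemeyer

open Matrix

/-! ### Nonnegative matrices with a unique final class -/

section Perron

variable {ι : Type*} [Fintype ι] {P : Matrix ι ι ℝ} {K : Set ι}

theorem mulVec_nonneg_of_nonneg (hP : ∀ i j, 0 ≤ P i j) {x : ι → ℝ} (hx : 0 ≤ x) :
    0 ≤ P *ᵥ x :=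
  fun i => Finset.sum_nonneg fun j _ => mul_nonneg (hP i j) (hx j)

theorem mulVec_mono_of_nonneg (hP : ∀ i j, 0 ≤ P i j) {x y : ι → ℝ} (hxy : x ≤ y) :
    P *ᵥ x ≤ P *ᵥ y :=
  fun i => Finset.sum_le_sum fun j _ => mul_le_mul_of_nonneg_left (hxy j) (hP i j)

variable [DecidableEq ι]

theorem pow_mulVec_of_eigen {x : ι → ℝ} {r : ℝ} (h : P *ᵥ x = r • x) (k : ℕ) :
    P ^ k *ᵥ x = r ^ k • x := by
  induction k with
  | zero => simp
  | succ k ih => rw [pow_succ, ← mulVec_mulVec, h, mulVec_smul, ih, smul_smul, pow_succ']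

theorem pow_mulVec_le_of_le (hP : ∀ i j, 0 ≤ P i j) {x : ι → ℝ} {r : ℝ} (hr : 0 ≤ r)
    (h : P *ᵥ x ≤ r • x) (k : ℕ) : P ^ k *ᵥ x ≤ r ^ k • x := by
  induction k with
  | zero => simp
  | succ k ih =>
    rw [pow_succ', ← mulVec_mulVec]
    refine (mulVec_mono_of_nonneg hP ih).trans ?_
    rw [mulVec_smul, pow_succ, mul_smul]
    exact smul_le_smul_of_nonneg_left h (pow_nonneg hr k)

/-- The support condition on `P` and `K` behind the Perron-Frobenius statements of this section:
`P` is a nonnegative matrix that preserves the vectors supported on `K`, and every nonzero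
nonnegative vector becomes positive on all of `K` under some positive power of `P`. So `K` is the unique
final class of `P`, and `P` restricted to it is primitive; the coordinates outside of `K` are
transient. -/
structure IsFinalClass (P : Matrix ι ι ℝ) (K : Set ι) : Prop where
  nonneg : ∀ i j, 0 ≤ P i j
  nonempty : K.Nonempty
  supp : ∀ x : ι → ℝ, (∀ i ∉ K, x i = 0) → ∀ i ∉ K, (P *ᵥ x) i = 0
  pos : ∀ x : ι → ℝ, 0 ≤ x → x ≠ 0 → ∃ k : ℕ, 0 < k ∧ ∀ i ∈ K, 0 < (P ^ k *ᵥ x) i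

theorem IsFinalClass.supp_pow (h : IsFinalClass P K) {x : ι → ℝ} (hx : ∀ i ∉ K, x i = 0) (k : ℕ) :
    ∀ i ∉ K, (P ^ k *ᵥ x) i = 0 := by
  induction k with
  | zero => simpa using hx
  | succ k ih =>
    rw [pow_succ', ← mulVec_mulVec]
    exact h.supp _ ih

theorem IsFinalClass.pow_mulVec_nonneg (h : IsFinalClass P K) {x : ι → ℝ} (hx : 0 ≤ x) (k : ℕ) :
    0 ≤ P ^ k *ᵥ x := by
  induction k with
  | zero => simpa using hx
  | succ k ih =>
    rw [pow_succ', ← mulVec_mulVec]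
    exact mulVec_nonneg_of_nonneg h.nonneg ih

theorem IsFinalClass.eigenvector_pos (h : IsFinalClass P K) {w : ι → ℝ} {r : ℝ} (hr : 0 < r)
    (hw : 0 ≤ w) (hw0 : w ≠ 0) (he : P *ᵥ w = r • w) : ∀ i ∈ K, 0 < w i := by
  obtain ⟨k, -, hk⟩ := h.pos w hw hw0
  intro i hi
  have := hk i hi
  rw [pow_mulVec_of_eigen he, Pi.smul_apply, smul_eq_mul] at this
  exact pos_of_mul_pos_right this (pow_nonneg hr.le k)

/-- Collatz-Wielandt: the largest `r` with `r • x ≤ P *ᵥ x` for some `x` in the face of the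
standard simplex spanned by `K` is an eigenvalue, since a nonzero difference `P *ᵥ x - r • x` would
become positive on `K` under a power of `P`, and `r` could be increased. -/
theorem IsFinalClass.exists_eigenvector (h : IsFinalClass P K) :
    ∃ (w : ι → ℝ) (r : ℝ), 0 < r ∧ w ∈ stdSimplex ℝ ι ∧ (∀ i ∉ K, w i = 0) ∧ P *ᵥ w = r • w := by
  have hP := h.nonneg
  set R : ℝ := ∑ i, ∑ j, P i j with hR
  let S : Set ((ι → ℝ) × ℝ) := (stdSimplex ℝ ι ×ˢ Set.Icc 0 R) ∩
    {p | (∀ i ∉ K, p.1 i = 0) ∧ p.2 • p.1 ≤ P *ᵥ p.1}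
  have hSc : IsCompact S := by
    refine ((isCompact_stdSimplex ℝ ι).prod isCompact_Icc).inter_right ?_
    refine IsClosed.inter ?_ ?_
    · have hset : {p : (ι → ℝ) × ℝ | ∀ i ∉ K, p.1 i = 0} = ⋂ i, ⋂ _ : i ∉ K, {p | p.1 i = 0} := by
        ext p
        simp
      have hcl : IsClosed {p : (ι → ℝ) × ℝ | ∀ i ∉ K, p.1 i = 0} := by
        rw [hset]
        exact isClosed_iInter fun i => isClosed_iInter fun _ =>
          isClosed_eq (by fun_prop) continuous_const
      exact hcl
    · exact isClosed_le (by fun_prop) (Continuous.matrix_mulVec continuous_const continuous_fst)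
  have hbound : ∀ x ∈ stdSimplex ℝ ι, ∀ r, r • x ≤ P *ᵥ x → r ≤ R := by
    intro x hx r hr
    have h1 : ∑ i, (r • x) i ≤ ∑ i, (P *ᵥ x) i := Finset.sum_le_sum fun i _ => hr i
    have h2 : ∑ i, (r • x) i = r := by
      simp [← Finset.mul_sum, hx.2]
    have h3 : ∑ i, (P *ᵥ x) i ≤ R := by
      refine Finset.sum_le_sum fun i _ => Finset.sum_le_sum fun j _ => ?_
      have : x j ≤ 1 := by
        rw [← hx.2]
        exact Finset.single_le_sum (fun k _ => hx.1 k) (Finset.mem_univ j)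
      exact mul_le_of_le_one_right (hP i j) this
    linarith
  have hR0 : 0 ≤ R := Finset.sum_nonneg fun i _ => Finset.sum_nonneg fun j _ => hP i j
  obtain ⟨i₀, hi₀⟩ := h.nonempty
  have hSne : S.Nonempty := by
    refine ⟨(Pi.single i₀ 1, 0), ⟨single_mem_stdSimplex ℝ i₀, le_refl _, hR0⟩, ?_, ?_⟩
    · intro i hi
      have : i ≠ i₀ := fun h => hi (h ▸ hi₀)
      simp [this]
    · simp only [zero_smul]
      exact mulVec_nonneg_of_nonneg hP (single_mem_stdSimplex ℝ i₀).1
  obtain ⟨⟨x, r⟩, hxS, hmax⟩ := hSc.exists_isMaxOn hSne continuous_snd.continuousOn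
  obtain ⟨⟨hx, hr0, -⟩, hxK, hrx⟩ := hxS
  simp only at hx hr0 hxK hrx
  have hx0 : x ≠ 0 := by
    rintro rfl
    simpa using hx.2
  have heig : P *ᵥ x = r • x := by
    by_contra hne
    have hd0 : 0 ≤ P *ᵥ x - r • x := sub_nonneg.2 hrx
    have hdne : P *ᵥ x - r • x ≠ 0 := sub_ne_zero.2 hne
    obtain ⟨k, -, hk⟩ := h.pos _ hd0 hdne
    set y := P ^ k *ᵥ x with hy
    have hyK : ∀ i ∉ K, y i = 0 := h.supp_pow hxK k
    have hy0 : 0 ≤ y := h.pow_mulVec_nonneg hx.1 k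
    have hPy : P ^ k *ᵥ (P *ᵥ x - r • x) = P *ᵥ y - r • y := by
      rw [mulVec_sub, mulVec_smul, hy, mulVec_mulVec, mulVec_mulVec, ← pow_succ, ← pow_succ']
    rw [hPy] at hk
    -- a uniform `ε` with `(r + ε) • y ≤ P *ᵥ y`
    obtain ⟨ε, hε, hle⟩ : ∃ ε > 0, (r + ε) • y ≤ P *ᵥ y := by
      have hex : ∀ i, ∃ ε > 0, ε * y i ≤ (P *ᵥ y - r • y) i := by
        intro i
        by_cases hi : i ∈ K
        · refine ⟨(P *ᵥ y - r • y) i / (y i + 1), div_pos (hk i hi) ?_, ?_⟩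
          · linarith [hy0 i, show (0 : ι → ℝ) i = 0 from rfl]
          · have h1 : 0 ≤ y i := hy0 i
            rw [div_mul_eq_mul_div, div_le_iff₀ (by linarith)]
            nlinarith [hk i hi]
        · refine ⟨1, one_pos, ?_⟩
          have := h.supp y hyK i hi
          simp [hyK i hi, this]
      choose ε hε hεle using hex
      obtain ⟨m, -, hm⟩ := Finset.exists_min_image Finset.univ ε ⟨i₀, Finset.mem_univ _⟩
      refine ⟨ε m, hε m, fun i => ?_⟩
      have h1 := hεle i
      have h2 : ε m * y i ≤ ε i * y i :=
        mul_le_mul_of_nonneg_right (hm i (Finset.mem_univ i)) (hy0 i)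
      simp only [Pi.sub_apply, Pi.smul_apply, smul_eq_mul] at h1 ⊢
      linarith
    have hypos : 0 < ∑ i, y i := by
      have hyne : ∑ i, y i ≠ 0 := by
        intro hs
        have h0 := (Finset.sum_eq_zero_iff_of_nonneg fun i _ => hy0 i).1 hs
        have hy00 : y = 0 := funext fun i => h0 i (Finset.mem_univ i)
        have := hk i₀ hi₀
        rw [hy00] at this
        simp at this
      exact lt_of_le_of_ne (Finset.sum_nonneg fun i _ => hy0 i) hyne.symm
    set z := (∑ i, y i)⁻¹ • y with hz
    have hzs : z ∈ stdSimplex ℝ ι := by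
      refine ⟨fun i => mul_nonneg (inv_nonneg.2 hypos.le) (hy0 i), ?_⟩
      simp only [hz, Pi.smul_apply, smul_eq_mul, ← Finset.mul_sum]
      exact inv_mul_cancel₀ hypos.ne'
    have hzle : (r + ε) • z ≤ P *ᵥ z := by
      rw [hz, mulVec_smul, smul_comm]
      exact smul_le_smul_of_nonneg_left hle (inv_nonneg.2 hypos.le)
    have hzS : (z, r + ε) ∈ S :=
      ⟨⟨hzs, by linarith, hbound z hzs _ hzle⟩, fun i hi => by simp [hz, hyK i hi], hzle⟩
    have := hmax hzS
    simp only [Set.mem_ofPred_eq] at this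
    linarith
  refine ⟨x, r, lt_of_le_of_ne hr0 ?_, hx, hxK, heig⟩
  rintro rfl
  obtain ⟨k, hk0, hk⟩ := h.pos x hx.1 hx0
  have := hk i₀ hi₀
  rw [pow_mulVec_of_eigen heig, zero_pow hk0.ne'] at this
  simp at this

/-- Subtract from `w` the largest multiple `c • w'` that keeps it nonnegative. The difference `d`
vanishes somewhere on `K` and satisfies `P *ᵥ d ≤ r • d`, so it cannot become positive on `K`. -/
theorem IsFinalClass.eq_of_eigenvector_of_le (h : IsFinalClass P K) {w w' : ι → ℝ} {r r' : ℝ}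
    (hr : 0 < r) (hrr : r ≤ r') (hw : w ∈ stdSimplex ℝ ι) (hw' : w' ∈ stdSimplex ℝ ι)
    (hK : ∀ i ∉ K, w' i = 0) (he : P *ᵥ w = r • w) (he' : P *ᵥ w' = r' • w') : w = w' := by
  have hw0' : ∃ i, 0 < w' i := by
    by_contra! hc
    have : ∑ i, w' i ≤ 0 := Finset.sum_nonpos fun i _ => hc i
    linarith [hw'.2]
  obtain ⟨i₁, hi₁⟩ := hw0'
  obtain ⟨m, hm, hmin⟩ := Finset.exists_min_image (Finset.univ.filter fun i => 0 < w' i)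
    (fun i => w i / w' i) ⟨i₁, by simpa using hi₁⟩
  simp only [Finset.mem_filter, Finset.mem_univ, true_and] at hm hmin
  set c : ℝ := w m / w' m with hc
  have hc0 : 0 ≤ c := div_nonneg (hw.1 m) hm.le
  set d : ι → ℝ := w - c • w' with hd
  have hd0 : 0 ≤ d := by
    intro i
    simp only [hd, Pi.zero_apply, Pi.sub_apply, Pi.smul_apply, smul_eq_mul, sub_nonneg]
    by_cases hi : 0 < w' i
    · exact (le_div_iff₀ hi).1 (hmin i hi)
    · rw [le_antisymm (not_lt.1 hi) (hw'.1 i), mul_zero]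
      exact hw.1 i
  have hdm : d m = 0 := by
    simp [hd, hc, div_mul_cancel₀ _ hm.ne']
  have hPd : P *ᵥ d ≤ r • d := by
    intro i
    simp only [hd, mulVec_sub, mulVec_smul, he, he', Pi.sub_apply, Pi.smul_apply, smul_eq_mul]
    nlinarith [mul_nonneg hc0 (mul_nonneg (sub_nonneg.2 hrr) (hw'.1 i))]
  have hdz : d = 0 := by
    by_contra hdne
    obtain ⟨k, -, hk⟩ := h.pos d hd0 hdne
    have hmK : m ∈ K := by
      by_contra hmK
      exact hm.ne' (hK m hmK)
    have h1 := hk m hmK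
    have h2 := pow_mulVec_le_of_le h.nonneg hr.le hPd k m
    rw [Pi.smul_apply, hdm, smul_zero] at h2
    linarith
  have hwc : w = c • w' := sub_eq_zero.1 hdz
  have hc1 : c = 1 := by
    have h1 := hw.2
    rw [hwc] at h1
    simpa [← Finset.mul_sum, hw'.2] using h1
  rw [hwc, hc1, one_smul]

theorem IsFinalClass.eq_of_eigenvector (h : IsFinalClass P K) {w w' : ι → ℝ} {r r' : ℝ}
    (hr : 0 < r) (hr' : 0 < r') (hw : w ∈ stdSimplex ℝ ι) (hw' : w' ∈ stdSimplex ℝ ι)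
    (hK : ∀ i ∉ K, w i = 0) (hK' : ∀ i ∉ K, w' i = 0)
    (he : P *ᵥ w = r • w) (he' : P *ᵥ w' = r' • w') : w = w' := by
  rcases le_total r r' with hle | hle
  · exact h.eq_of_eigenvector_of_le hr hle hw hw' hK' he he'
  · exact (h.eq_of_eigenvector_of_le hr' hle hw' hw hK he' he).symm

/-- A nonnegative eigenvector is, up to scaling, the only eigenvector for its eigenvalue among all
real vectors supported on `K`: it is positive on `K`, so a small perturbation along another such
vector stays nonnegative. -/
theorem IsFinalClass.eq_of_supp (h : IsFinalClass P K) {w v : ι → ℝ} {r : ℝ} (hr : 0 < r)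
    (hw : w ∈ stdSimplex ℝ ι) (hK : ∀ i ∉ K, w i = 0) (he : P *ᵥ w = r • w)
    (hv : ∑ i, v i = 1) (hvK : ∀ i ∉ K, v i = 0) (hev : P *ᵥ v = r • v) : v = w := by
  have hw0 : w ≠ 0 := by
    rintro rfl
    simpa using hw.2
  have hpos := h.eigenvector_pos hr hw.1 hw0 he
  obtain ⟨ε, hε, hle⟩ : ∃ ε > 0, ∀ i, 0 ≤ w i + ε * (v i - w i) := by
    have hex : ∀ i, ∃ ε > 0, ∀ δ, 0 ≤ δ → δ ≤ ε → 0 ≤ w i + δ * (v i - w i) := by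
      intro i
      by_cases hi : i ∈ K
      · have hwi := hpos i hi
        refine ⟨w i / (|v i - w i| + 1), by positivity, fun δ h0 h1 => ?_⟩
        rw [le_div_iff₀ (by positivity)] at h1
        nlinarith [neg_abs_le (v i - w i), mul_le_mul_of_nonneg_left (neg_abs_le (v i - w i)) h0]
      · exact ⟨1, one_pos, fun δ _ _ => by simp [hK i hi, hvK i hi]⟩
    choose ε hε hεle using hex
    obtain ⟨i₀, -⟩ := h.nonempty
    obtain ⟨m, -, hm⟩ := Finset.exists_min_image Finset.univ ε ⟨i₀, Finset.mem_univ _⟩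
    exact ⟨ε m, hε m, fun i => hεle i _ (hε m).le (hm i (Finset.mem_univ i))⟩
  have hz : w + ε • (v - w) = w := by
    refine h.eq_of_eigenvector hr hr ⟨hle, ?_⟩ hw (fun i hi => ?_) hK ?_ he
    · simp [Finset.sum_add_distrib, ← Finset.mul_sum, Finset.sum_sub_distrib, hv, hw.2]
    · simp [hK i hi, hvK i hi]
    · simp only [mulVec_add, mulVec_smul, mulVec_sub, he, hev]
      module
  have : ε • (v - w) = 0 := by simpa using hz
  exact sub_eq_zero.1 ((smul_eq_zero.1 this).resolve_left hε.ne')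

end Perron

/-! ### Descent of unique solutions to subfields -/

section Descent

/-- If a real vector is fixed by every `F`-linear retraction `ℝ → F`, its entries are in `F`. The
unique solution of a linear system over `F` satisfies the hypothesis, since a retraction maps
solutions to solutions. -/
theorem mem_of_forall_retraction {ι : Type*} (F : IntermediateField ℚ ℝ) {w : ι → ℝ}
    (h : ∀ π : ℝ →ₗ[F] F, (∀ x : F, π (x : ℝ) = x) → (fun i => (π (w i) : ℝ)) = w) (i : ι) :
    w i ∈ F := by
  obtain ⟨π, hπ⟩ := LinearMap.exists_leftInverse_of_injective (Algebra.linearMap F ℝ)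
    (LinearMap.ker_eq_bot.2 (algebraMap F ℝ).injective)
  rw [← h π fun x => LinearMap.congr_fun hπ x]
  exact (π (w i)).2

theorem mulVec_mem {ι κ : Type*} [Fintype ι] (F : IntermediateField ℚ ℝ) {N : Matrix κ ι ℝ}
    (hN : ∀ i j, N i j ∈ F) {w : ι → ℝ} (hw : ∀ i, w i ∈ F) (i : κ) : (N *ᵥ w) i ∈ F :=
  F.toSubfield.toSubring.sum_mem fun j _ => F.mul_mem (hN i j) (hw j)

theorem retraction_mulVec {ι κ : Type*} [Fintype ι] {F : IntermediateField ℚ ℝ} (π : ℝ →ₗ[F] F)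
    {N : Matrix κ ι ℝ} (hN : ∀ i j, N i j ∈ F) (w : ι → ℝ) :
    (fun i => (π ((N *ᵥ w) i) : ℝ)) = N *ᵥ fun i => (π (w i) : ℝ) := by
  ext i
  simp only [mulVec, dotProduct, map_sum]
  push_cast
  refine Finset.sum_congr rfl fun j _ => ?_
  have := π.map_smul ⟨N i j, hN i j⟩ (w j)
  rw [show N i j * w j = (⟨N i j, hN i j⟩ : F) • w j from rfl, this]
  rfl

end Descent

/-! ### The scalar recursion -/

section Runs

/-- The scalar form of an orbit of the matrices `A_a`, `B_a`: at time `t` the vector has entry `u t`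
in the first position and, the middle entries being merely shifted, the entry `y (t + n - j)` in
position `j ≥ 1`. The constant `c` is `1` for `A_a` and `1 / 2` for `B_a`; the letter used at time
`t` is `b t`. -/
structure IsRun (n : ℕ) (b : ℕ → Fin 2) (c : ℝ) (u y : ℕ → ℝ) : Prop where
  u_succ : ∀ t, u (t + 1) = (if b t = 0 then u t else 0) + c * y t
  y_add : ∀ t, y (t + n) = (if b t = 1 then u t else 0) + c * y t

/-- The residue class of `t` modulo `n` contains a time at which the letter is `1`. Only in these
classes does the sequence `y` of a run receive contributions from `u`. -/
def Live (n : ℕ) (b : ℕ → Fin 2) (t : ℕ) : Prop :=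
  ∃ t', t' ≡ t [MOD n] ∧ b t' = 1

variable {n s : ℕ} {b : ℕ → Fin 2} {c : ℝ} {u y : ℕ → ℝ}

theorem Live.congr {t t' : ℕ} (h : Live n b t) (ht : t ≡ t' [MOD n]) : Live n b t' := by
  obtain ⟨r, hr, hb⟩ := h
  exact ⟨r, hr.trans ht, hb⟩

theorem periodic_add_mul (hb : ∀ t, b (t + s) = b t) (t k : ℕ) : b (t + k * s) = b t :=
  (Function.Periodic.nat_mul (f := b) hb k) t

theorem Live.of_add (hn : 1 ≤ n) (hb : ∀ t, b (t + s) = b t) {t : ℕ} (h : Live n b (t + s)) :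
    Live n b t := by
  obtain ⟨r, hr, hb1⟩ := h
  refine ⟨r + (n - 1) * s, ?_, by rw [periodic_add_mul hb, hb1]⟩
  have h1 := hr.add_right ((n - 1) * s)
  obtain ⟨m, rfl⟩ : ∃ m, n = m + 1 := ⟨n - 1, by omega⟩
  have h2 : t + s + (m + 1 - 1) * s = t + s * (m + 1) := by
    simp only [Nat.add_sub_cancel]
    ring
  rw [h2] at h1
  exact h1.trans (by simp [Nat.ModEq])

theorem IsRun.y_add_mul_of_not_live (h : IsRun n b c u y) {t : ℕ} (ht : ¬ Live n b t) (m : ℕ) :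
    y (t + m * n) = c ^ m * y t := by
  induction m with
  | zero => simp
  | succ m ih =>
    have hb : b (t + m * n) ≠ 1 := fun hb => ht ⟨t + m * n, by simp [Nat.ModEq], hb⟩
    rw [show t + (m + 1) * n = t + m * n + n by ring, h.y_add, if_neg hb, ih]
    ring

theorem IsRun.y_pos_add_mul (h : IsRun n b c u y) (hc : 0 < c) (hu : ∀ t, 0 ≤ u t) {t : ℕ}
    (ht : 0 < y t) (m : ℕ) : 0 < y (t + m * n) := by
  induction m with
  | zero => simpa using ht
  | succ m ih =>
    rw [show t + (m + 1) * n = t + m * n + n by ring, h.y_add]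
    have := mul_pos hc ih
    split_ifs <;> linarith [hu (t + m * n)]

theorem exists_add_mul_of_modEq {t t' : ℕ} (h : t' ≡ t [MOD n]) (hle : t' ≤ t) :
    ∃ m, t = t' + m * n := by
  obtain ⟨m, hm⟩ := (Nat.modEq_iff_dvd' hle).1 h
  exact ⟨m, by rw [mul_comm]; omega⟩

/-- Each residue class modulo `n` is either eventually positive or identically zero for `y`. -/
theorem IsRun.exists_forall_y_pos (h : IsRun n b c u y) (hn : 1 ≤ n) (hc : 0 < c)
    (hu : ∀ t, 0 ≤ u t) :
    ∃ T, ∀ t ≥ T, ∀ t', t' ≡ t [MOD n] → 0 < y t' → 0 < y t := by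
  have hr : ∀ r, ∃ T, ∀ t ≥ T, t % n = r → ∀ t', t' ≡ t [MOD n] → 0 < y t' → 0 < y t := by
    intro r
    by_cases hal : ∃ t', t' % n = r ∧ 0 < y t'
    · obtain ⟨t₀, ht₀, hy₀⟩ := hal
      refine ⟨t₀, fun t ht htr _ _ _ => ?_⟩
      obtain ⟨m, rfl⟩ := exists_add_mul_of_modEq (n := n) (ht₀.trans htr.symm) ht
      exact h.y_pos_add_mul hc hu hy₀ m
    · exact ⟨0, fun t _ htr t' htt' hy' => absurd ⟨t', Eq.trans htt' htr, hy'⟩ hal⟩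
  choose T hT using hr
  refine ⟨(Finset.range n).sup T, fun t ht => hT (t % n) t (le_trans ?_ ht) rfl⟩
  exact Finset.le_sup (Finset.mem_range.2 (Nat.mod_lt _ hn))

/-- A nonzero nonnegative run is eventually positive at `u` and in all live classes of `y`. Once no
further class of `y` becomes positive, `u` cannot lose its mass to a class that stays zero; so `u`
stays positive and feeds every live class. -/
theorem IsRun.eventually_pos (h : IsRun n b c u y) (hn : 1 ≤ n) (hs : 0 < s)
    (hb : ∀ t, b (t + s) = b t) (hc : 0 < c) (hu : ∀ t, 0 ≤ u t) (hy : ∀ t, 0 ≤ y t)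
    (h0 : 0 < u 0 ∨ ∃ t, 0 < y t) : ∃ T, ∀ t ≥ T, 0 < u t ∧ (Live n b t → 0 < y t) := by
  obtain ⟨T₀, hT₀⟩ := h.exists_forall_y_pos hn hc hu
  have hustep : ∀ t, 0 < y t → 0 < u (t + 1) := by
    intro t ht
    rw [h.u_succ]
    have := mul_pos hc ht
    split_ifs <;> linarith [hu t]
  have hyfeed : ∀ t, b t = 1 → 0 < u t → 0 < y (t + n) := by
    intro t hbt ht
    rw [h.y_add, if_pos hbt]
    have := mul_nonneg hc.le (hy t)
    linarith
  have hkeep : ∀ t, b t ≠ 1 → 0 < u t → 0 < u (t + 1) := by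
    intro t hbt ht
    rw [h.u_succ, if_pos (by omega)]
    have := mul_nonneg hc.le (hy t)
    linarith
  have hex : ∃ t ≥ T₀, 0 < u t := by
    by_contra! hno
    have hyz : ∀ t, y t = 0 := by
      intro t
      by_contra hne
      have hpos := h.y_pos_add_mul hc hu (lt_of_le_of_ne (hy t) (Ne.symm hne)) T₀
      have hge : T₀ ≤ t + T₀ * n + 1 := by nlinarith
      linarith [hno _ hge, hustep _ hpos]
    rcases h0 with h0 | ⟨t, ht⟩
    · have hup : ∀ t, 0 < u t := by
        intro t
        induction t with
        | zero => exact h0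
        | succ t ih =>
          refine hkeep t (fun hbt => ?_) ih
          exact (hyfeed t hbt ih).ne' (hyz _)
      exact (hup T₀).not_ge (hno T₀ le_rfl)
    · exact ht.ne' (hyz t)
  obtain ⟨t₁, ht₁, hu₁⟩ := hex
  have hup : ∀ t ≥ t₁, 0 < u t := by
    intro t ht
    induction t, ht using Nat.le_induction with
    | base => exact hu₁
    | succ t ht ih =>
      by_cases hbt : b t = 1
      · exact hustep t (hT₀ t (ht₁.trans ht) (t + n) (by simp [Nat.ModEq]) (hyfeed t hbt ih))
      · exact hkeep t hbt ih
  refine ⟨t₁, fun t ht => ⟨hup t ht, ?_⟩⟩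
  rintro ⟨t', htt', hbt'⟩
  -- move `t'` beyond `t₁` inside its residue class, by a multiple of the period
  have hb2 : b (t' + (t₁ * n) * s) = 1 := by rw [periodic_add_mul hb, hbt']
  have hge : t₁ ≤ t' + (t₁ * n) * s := by
    have : t₁ * 1 * 1 ≤ t₁ * n * s := Nat.mul_le_mul (Nat.mul_le_mul le_rfl hn) hs
    omega
  refine hT₀ t (ht₁.trans ht) _ ?_ (hyfeed _ hb2 (hup _ hge))
  have : t' + t₁ * n * s + n = t' + n * (t₁ * s + 1) := by ring
  rw [this]
  exact Nat.ModEq.trans (by simp [Nat.ModEq]) htt'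

/-- The total mass of a run at time `t`, that is, the sum of the entries of the vector. -/
def mass (n : ℕ) (u y : ℕ → ℝ) (t : ℕ) : ℝ :=
  u t + ∑ i ∈ Finset.range n, y (t + i)

theorem IsRun.mass_succ (h : IsRun n b c u y) (t : ℕ) :
    mass n u y (t + 1) = mass n u y t + (2 * c - 1) * y t := by
  have h1 : ∑ i ∈ Finset.range n, y (t + 1 + i) + y t
      = ∑ i ∈ Finset.range n, y (t + i) + y (t + n) := by
    rw [← Finset.sum_range_succ (fun i => y (t + i)),
      Finset.sum_range_succ' (fun i => y (t + i))]
    simp only [add_zero, add_left_inj]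
    exact Finset.sum_congr rfl fun i _ => by rw [add_assoc, add_comm 1 i]
  have h2 := h.u_succ t
  have h3 := h.y_add t
  rcases (show b t = 0 ∨ b t = 1 by omega) with hb | hb
  all_goals
    simp only [hb, reduceIte, zero_ne_one, one_ne_zero] at h2 h3
    simp only [mass]
    linarith

theorem IsRun.mass_monotone (h : IsRun n b c u y) (hc : 1 / 2 ≤ c) (hy : ∀ t, 0 ≤ y t) :
    Monotone (mass n u y) := by
  refine monotone_nat_of_le_succ fun t => ?_
  rw [h.mass_succ]
  nlinarith [mul_nonneg (show 0 ≤ 2 * c - 1 by linarith) (hy t)]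

theorem mass_add_of_eigen {r : ℝ} (hu : ∀ t, u (t + s) = r * u t) (hy : ∀ t, y (t + s) = r * y t)
    (t : ℕ) : mass n u y (t + s) = r * mass n u y t := by
  simp only [mass, hu, mul_add, Finset.mul_sum]
  congr 1
  exact Finset.sum_congr rfl fun i _ => by rw [← hy, add_right_comm]

/-- A nonnegative run that is multiplied by `r > 0` over one period vanishes on all classes that are
not live. On such a class `n` periods multiply `y` by `c ^ s`, so `y t ≠ 0` gives `r ^ n = c ^ s ≤ 1`;
as the mass does not decrease, `r = 1` and `c = 1`, and then `y t` would increase the mass. -/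
theorem IsRun.y_eq_zero_of_not_live (h : IsRun n b c u y) (hn : 1 ≤ n) (hs : 0 < s)
    (hc : 1 / 2 ≤ c) (hc1 : c ≤ 1) (hu0 : ∀ t, 0 ≤ u t) (hy0 : ∀ t, 0 ≤ y t) {r : ℝ} (hr : 0 < r)
    (hu : ∀ t, u (t + s) = r * u t) (hy : ∀ t, y (t + s) = r * y t) {t : ℕ}
    (ht : ¬ Live n b t) : y t = 0 := by
  by_contra hne
  have hpos : 0 < y t := lt_of_le_of_ne (hy0 t) (Ne.symm hne)
  have hpow : ∀ k, y (t + k * s) = r ^ k * y t := by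
    intro k
    induction k with
    | zero => simp
    | succ k ih => rw [show t + (k + 1) * s = t + k * s + s by ring, hy, ih]; ring
  have hrc : r ^ n = c ^ s := by
    have h1 := h.y_add_mul_of_not_live ht s
    rw [mul_comm, hpow n] at h1
    exact mul_right_cancel₀ hne h1
  have hmpos : 0 < mass n u y t := by
    refine add_pos_of_nonneg_of_pos (hu0 t) (Finset.sum_pos' (fun i _ => hy0 _) ⟨0, ?_, ?_⟩)
    · exact Finset.mem_range.2 hn
    · simpa using hpos
  have hr1 : 1 ≤ r := by
    have h1 := h.mass_monotone hc hy0 (show t ≤ t + s by omega)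
    rw [mass_add_of_eigen hu hy] at h1
    nlinarith
  have hcs : c ^ s = 1 :=
    le_antisymm (pow_le_one₀ (by linarith) hc1) (hrc ▸ one_le_pow₀ hr1)
  have hc' : c = 1 := (pow_eq_one_iff_of_nonneg (by linarith) hs.ne').1 hcs
  have hr' : r = 1 :=
    (pow_eq_one_iff_of_nonneg hr.le (by omega)).1 (hrc.trans hcs)
  have h1 := h.mass_monotone hc hy0 (show t + 1 ≤ t + s by omega)
  rw [mass_add_of_eigen hu hy, h.mass_succ, hr', hc'] at h1
  linarith

end Runs

/-! ### The matrices of the letters -/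

section Letters

/-- The matrix `A_a` with its last column multiplied by `c`; it is `A_a` for `c = 1` and `B_a` for
`c = 1 / 2`. -/
noncomputable def C (n : ℕ) (c : ℝ) (a : Fin 2) : Matrix (Fin (n + 1)) (Fin (n + 1)) ℝ :=
  Matrix.of fun i j => if j = Fin.last n then c * A n a i j else A n a i j

theorem C_one (n : ℕ) : C n 1 = A n := by
  ext a i j
  simp [C]

theorem C_half (n : ℕ) : C n (1 / 2) = B n := by
  ext a i j
  simp only [C, B, of_apply]
  split_ifs <;> ring

variable {n : ℕ} {c : ℝ} {a : Fin 2}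

theorem C_nonneg (hc : 0 ≤ c) (i j : Fin (n + 1)) : 0 ≤ C n c a i j := by
  have : 0 ≤ A n a i j := by
    simp only [A, of_apply]
    split_ifs <;> norm_num
  simp only [C, of_apply]
  split_ifs
  exacts [mul_nonneg hc this, this]

theorem C_mulVec_zero (hn : 1 ≤ n) (x : Fin (n + 1) → ℝ) :
    (C n c a *ᵥ x) 0 = (if a = 0 then x 0 else 0) + c * x (Fin.last n) := by
  have hent : ∀ j, C n c a 0 j * x j = (if j = 0 then (if a = 0 then x 0 else 0) else 0)
      + if j = Fin.last n then c * x (Fin.last n) else 0 := by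
    intro j
    rcases (show a = 0 ∨ a = 1 by omega) with rfl | rfl
    all_goals
      by_cases h0 : j = 0
      · subst h0
        have h1 : (0 : Fin (n + 1)) ≠ Fin.last n := by
          intro h
          have := congrArg Fin.val h
          simp at this
          omega
        have h2 : ¬ (0 = n) := by omega
        simp [C, A, h1, h2]
      · by_cases h1 : j = Fin.last n
        · subst h1
          simp [C, A, h0]
        · have h2 : j.val ≠ 0 := fun h => h0 (Fin.ext h)
          have h3 : j.val ≠ n := fun h => h1 (Fin.ext h)
          simp [C, A, h0, h1, h3]
  simp only [mulVec, dotProduct, hent, Finset.sum_add_distrib, Finset.sum_ite_eq',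
    Finset.mem_univ, if_true]

theorem C_mulVec_one (hn : 1 ≤ n) (x : Fin (n + 1) → ℝ) :
    (C n c a *ᵥ x) ⟨1, by omega⟩ = (if a = 1 then x 0 else 0) + c * x (Fin.last n) := by
  have hent : ∀ j, C n c a ⟨1, by omega⟩ j * x j
      = (if j = 0 then (if a = 1 then x 0 else 0) else 0)
      + if j = Fin.last n then c * x (Fin.last n) else 0 := by
    intro j
    rcases (show a = 0 ∨ a = 1 by omega) with rfl | rfl
    all_goals
      by_cases h0 : j = 0
      · subst h0
        have h1 : (0 : Fin (n + 1)) ≠ Fin.last n := by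
          intro h
          have := congrArg Fin.val h
          simp at this
          omega
        have h2 : ¬ (0 = n) := by omega
        simp [C, A, h1, h2]
      · by_cases h1 : j = Fin.last n
        · subst h1
          simp [C, A, h0]
        · have h2 : j.val ≠ 0 := fun h => h0 (Fin.ext h)
          have h3 : j.val ≠ n := fun h => h1 (Fin.ext h)
          have h4 : ¬ (1 ≤ j.val ∧ 1 = j.val + 1) := by omega
          simp [C, A, h0, h1, h3]
  simp only [mulVec, dotProduct, hent, Finset.sum_add_distrib, Finset.sum_ite_eq',
    Finset.mem_univ, if_true]

theorem C_mulVec_succ (x : Fin (n + 1) → ℝ) {j : ℕ} (hj : 1 ≤ j) (hjn : j < n) :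
    (C n c a *ᵥ x) ⟨j + 1, by omega⟩ = x ⟨j, by omega⟩ := by
  have hent : ∀ i, C n c a ⟨j + 1, by omega⟩ i * x i
      = if i = ⟨j, by omega⟩ then x ⟨j, by omega⟩ else 0 := by
    intro i
    have ha := a.isLt
    by_cases hi : i = ⟨j, by omega⟩
    · subst hi
      have h1 : (⟨j, by omega⟩ : Fin (n + 1)) ≠ Fin.last n := by
        intro h
        have := congrArg Fin.val h
        simp at this
        omega
      simp [C, A, h1, hj]
    · have h2 : i.val ≠ j := fun h => hi (Fin.ext h)
      have h3 : A n a ⟨j + 1, by omega⟩ i = 0 := by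
        simp only [A, of_apply]
        rw [if_neg]
        omega
      simp [C, h3, hi]
  simp only [mulVec, dotProduct, hent, Finset.sum_ite_eq', Finset.mem_univ, if_true]

theorem isUnit_of_mulVec_eq_zero {m : Type*} [Fintype m] [DecidableEq m] {N : Matrix m m ℝ}
    (h : ∀ x, N *ᵥ x = 0 → x = 0) : IsUnit N := by
  rw [← mulVec_injective_iff_isUnit]
  intro x y hxy
  refine sub_eq_zero.1 (h _ ?_)
  rw [mulVec_sub, sub_eq_zero]
  exact hxy

theorem C_isUnit (hn : 1 ≤ n) (hc : 0 < c) : IsUnit (C n c a) := by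
  refine isUnit_of_mulVec_eq_zero fun x hx => ?_
  have h0 := C_mulVec_zero (c := c) (a := a) hn x
  have h1 := C_mulVec_one (c := c) (a := a) hn x
  rw [hx] at h0 h1
  simp only [Pi.zero_apply] at h0 h1
  have hl : x (Fin.last n) = 0 ∧ x 0 = 0 := by
    rcases (show a = 0 ∨ a = 1 by omega) with rfl | rfl
    all_goals
      simp only [reduceIte, zero_ne_one, one_ne_zero, zero_add] at h0 h1
    · have := (mul_eq_zero.1 h1.symm).resolve_left hc.ne'
      rw [this] at h0
      exact ⟨this, by linarith⟩
    · have := (mul_eq_zero.1 h0.symm).resolve_left hc.ne'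
      rw [this] at h1
      exact ⟨this, by linarith⟩
  ext ⟨j, hj⟩
  rcases Nat.eq_zero_or_pos j with rfl | hj0
  · exact hl.2
  rcases (show j = n ∨ j < n by omega) with rfl | hjn
  · exact hl.1
  · rw [← C_mulVec_succ (c := c) (a := a) x hj0 hjn, hx]
    rfl

theorem V_isUnit (n : ℕ) : IsUnit (V n) := by
  refine isUnit_of_mulVec_eq_zero fun x hx => ?_
  -- the sums of the entries of `x` over `{1, …, k}`, and over all indices, vanish
  have hrow : ∀ k, 1 ≤ k → k ≤ n →
      ∑ j : Fin (n + 1), (if 1 ≤ j.val ∧ j.val ≤ k then x j else 0) = 0 := by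
    intro k hk hkn
    have h1 := congrFun hx ⟨n - k, by omega⟩
    simp only [mulVec, dotProduct, Pi.zero_apply] at h1
    refine Eq.trans (Finset.sum_congr rfl fun j _ => ?_) h1
    have h2 : (n - k = n ∨ (1 ≤ j.val ∧ n - k + j.val ≤ n)) ↔ (1 ≤ j.val ∧ j.val ≤ k) := by omega
    simp only [V, of_apply, h2, ite_mul, one_mul, zero_mul]
  have hpos : ∀ k (hk : 1 ≤ k) (hkn : k ≤ n), x ⟨k, by omega⟩ = 0 := by
    intro k hk hkn
    have hdiff : ∑ j : Fin (n + 1), (if j = ⟨k, by omega⟩ then x j else 0)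
        = ∑ j : Fin (n + 1), (if 1 ≤ j.val ∧ j.val ≤ k then x j else 0)
        - ∑ j : Fin (n + 1), (if 1 ≤ j.val ∧ j.val ≤ k - 1 then x j else 0) := by
      rw [← Finset.sum_sub_distrib]
      refine Finset.sum_congr rfl fun j _ => ?_
      have h3 : j = ⟨k, by omega⟩ ↔ j.val = k := Fin.ext_iff
      simp only [h3]
      by_cases h4 : j.val = k
      · rw [if_pos h4, if_pos (by omega), if_neg (by omega), sub_zero]
      · by_cases h5 : 1 ≤ j.val ∧ j.val ≤ k
        · rw [if_neg h4, if_pos h5, if_pos (by omega), sub_self]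
        · rw [if_neg h4, if_neg h5, if_neg (by omega), sub_self]
    rw [Finset.sum_ite_eq' , if_pos (Finset.mem_univ _), hrow k hk hkn, zero_sub] at hdiff
    rw [hdiff, neg_eq_zero]
    rcases (show k = 1 ∨ 2 ≤ k by omega) with rfl | hk2
    · exact Finset.sum_eq_zero fun j _ => if_neg (by omega)
    · exact hrow (k - 1) (by omega) (by omega)
  have hlast : ∑ j, x j = 0 := by
    have h1 := congrFun hx (Fin.last n)
    simpa [mulVec, dotProduct, V] using h1
  ext ⟨j, hj⟩
  rcases Nat.eq_zero_or_pos j with rfl | hj0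
  · rw [Fin.sum_univ_succ] at hlast
    have : ∑ i : Fin n, x i.succ = 0 :=
      Finset.sum_eq_zero fun i _ => hpos (i.val + 1) (by omega) (by omega)
    rw [this, add_zero] at hlast
    exact hlast
  · exact hpos j hj0 (by omega)

end Letters

/-! ### Orbits of vectors -/

section Orbits

/-- The orbit of `w` under the matrices `C n c (b 0)`, `C n c (b 1)`, …. -/
noncomputable def orbit (n : ℕ) (c : ℝ) (b : ℕ → Fin 2) (w : Fin (n + 1) → ℝ) :
    ℕ → Fin (n + 1) → ℝ
  | 0 => w
  | t + 1 => C n c (b t) *ᵥ orbit n c b w t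

variable {n s : ℕ} {c : ℝ} {b : ℕ → Fin 2}

theorem orbit_shift (w : Fin (n + 1) → ℝ) (t : ℕ) {j : ℕ} (hj : 1 ≤ j) (i : ℕ) (hi : j + i ≤ n) :
    orbit n c b w (t + i) ⟨j + i, by omega⟩ = orbit n c b w t ⟨j, by omega⟩ := by
  induction i with
  | zero => rfl
  | succ i ih =>
    rw [← ih (by omega)]
    exact C_mulVec_succ (j := j + i) _ (by omega) (by omega)

theorem orbit_apply (w : Fin (n + 1) → ℝ) (t : ℕ) {j : ℕ} (hj : 1 ≤ j) (hjn : j ≤ n) :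
    orbit n c b w t ⟨j, by omega⟩ = orbit n c b w (t + (n - j)) (Fin.last n) := by
  rw [← orbit_shift w t hj (n - j) (by omega)]
  congr 1
  ext
  simp only [Fin.val_last]
  omega

theorem orbit_isRun (hn : 1 ≤ n) (w : Fin (n + 1) → ℝ) :
    IsRun n b c (fun t => orbit n c b w t 0) (fun t => orbit n c b w t (Fin.last n)) where
  u_succ t := C_mulVec_zero hn _
  y_add t := by
    have h := orbit_apply (c := c) (b := b) w (t + 1) le_rfl hn
    rw [show t + 1 + (n - 1) = t + n by omega] at h
    rw [← h]
    exact C_mulVec_one hn _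

theorem orbit_nonneg (hc : 0 ≤ c) {w : Fin (n + 1) → ℝ} (hw : 0 ≤ w) (t : ℕ) :
    0 ≤ orbit n c b w t := by
  induction t with
  | zero => exact hw
  | succ t ih => exact mulVec_nonneg_of_nonneg (C_nonneg hc) ih

theorem orbit_add (hb : ∀ t, b (t + s) = b t) (w : Fin (n + 1) → ℝ) (t : ℕ) :
    orbit n c b w (t + s) = orbit n c b (orbit n c b w s) t := by
  induction t with
  | zero => rw [zero_add]; rfl
  | succ t ih =>
    rw [add_right_comm]
    simp only [orbit, ih, hb]

theorem orbit_smul (r : ℝ) (w : Fin (n + 1) → ℝ) (t : ℕ) :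
    orbit n c b (r • w) t = r • orbit n c b w t := by
  induction t with
  | zero => rfl
  | succ t ih => simp only [orbit, ih, mulVec_smul]

/-- The first coordinate, and those positions `j ≥ 1` whose entry at time `0` is `y (n - j)` for a
live residue class. When `b` has period `s`, this is the final class of the matrix that carries out
the first `s` steps. -/
def finalClass (n : ℕ) (b : ℕ → Fin 2) : Set (Fin (n + 1)) :=
  {j | j = 0 ∨ Live n b (n - j.val)}

theorem supp_finalClass_iff (hn : 1 ≤ n) (w : Fin (n + 1) → ℝ) :
    (∀ j ∉ finalClass n b, w j = 0) ↔
      ∀ t, ¬ Live n b t → orbit n c b w t (Fin.last n) = 0 := by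
  constructor
  · intro h t ht
    have hmod : t % n < n := Nat.mod_lt _ hn
    have hnl : ¬ Live n b (t % n) := fun hl => ht (hl.congr (Nat.mod_modEq t n))
    have h1 := (orbit_isRun (c := c) (b := b) hn w).y_add_mul_of_not_live hnl (t / n)
    rw [Nat.mod_add_div' t n] at h1
    have h2 := orbit_apply (c := c) (b := b) w 0 (j := n - t % n) (by omega) (by omega)
    rw [show 0 + (n - (n - t % n)) = t % n by omega] at h2
    rw [h1, ← h2]
    have h3 : orbit n c b w 0 ⟨n - t % n, by omega⟩ = 0 := by
      refine h _ ?_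
      rintro (h0 | hl)
      · have := congrArg Fin.val h0
        simp only [Fin.val_zero] at this
        omega
      · rw [show n - (n - t % n) = t % n by omega] at hl
        exact hnl hl
    rw [h3, mul_zero]
  · rintro h ⟨j, hj⟩ hjK
    have hj0 : 1 ≤ j := by
      by_contra h0
      exact hjK (Or.inl (Fin.ext (by simp only [Fin.val_zero]; omega)))
    have h2 := orbit_apply (c := c) (b := b) w 0 hj0 (by omega)
    rw [zero_add, h _ fun hl => hjK (Or.inr hl)] at h2
    exact h2

theorem isFinalClass_of_orbit (hn : 1 ≤ n) (hs : 0 < s) (hb : ∀ t, b (t + s) = b t) (hc : 0 < c)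
    {P : Matrix (Fin (n + 1)) (Fin (n + 1)) ℝ} (hP0 : ∀ i j, 0 ≤ P i j)
    (hP : ∀ w, orbit n c b w s = P *ᵥ w) : IsFinalClass P (finalClass n b) where
  nonneg := hP0
  nonempty := ⟨0, Or.inl rfl⟩
  supp x hx := by
    rw [supp_finalClass_iff (c := c) hn] at hx ⊢
    intro t ht
    rw [← hP, ← orbit_add hb]
    exact hx _ fun hl => ht (hl.of_add hn hb)
  pos x hx hx0 := by
    have hrun := orbit_isRun (c := c) (b := b) hn x
    have hpow : ∀ k, P ^ k *ᵥ x = orbit n c b x (k * s) := by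
      intro k
      induction k with
      | zero => simp [orbit]
      | succ k ih =>
        have hbk : ∀ t, b (t + k * s) = b t := fun t => periodic_add_mul hb t k
        rw [pow_succ', ← mulVec_mulVec, ih, ← hP, ← orbit_add hbk,
          show s + k * s = (k + 1) * s by ring]
    have hstart : 0 < orbit n c b x 0 0 ∨ ∃ t, 0 < orbit n c b x t (Fin.last n) := by
      by_contra! hno
      refine hx0 (funext fun ⟨j, hj⟩ => le_antisymm ?_ (hx _))
      rcases Nat.eq_zero_or_pos j with rfl | hj0
      · exact hno.1
      · exact (orbit_apply (c := c) (b := b) x 0 hj0 (by omega)).trans_le (hno.2 _)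
    obtain ⟨T, hT⟩ := hrun.eventually_pos hn hs hb hc (fun t => orbit_nonneg hc.le hx t 0)
      (fun t => orbit_nonneg hc.le hx t _) hstart
    have hge : T ≤ (T + 1) * s := by nlinarith
    refine ⟨T + 1, by omega, ?_⟩
    rintro ⟨j, hj⟩ hjK
    rw [hpow]
    rcases Nat.eq_zero_or_pos j with rfl | hj0
    · exact (hT _ hge).1
    · rw [orbit_apply x _ hj0 (by omega)]
      refine (hT _ (by omega)).2 ?_
      rcases hjK with h0 | ⟨t', ht', hbt'⟩
      · exact absurd (congrArg Fin.val h0) (by simp only [Fin.val_zero]; omega)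
      · refine ⟨t' + (T + 1) * s, ?_, by rw [periodic_add_mul hb, hbt']⟩
        rw [add_comm ((T + 1) * s)]
        exact ht'.add_right _

theorem orbit_add_of_eigen (hb : ∀ t, b (t + s) = b t) {w : Fin (n + 1) → ℝ} {r : ℝ}
    (he : orbit n c b w s = r • w) (t : ℕ) (i : Fin (n + 1)) :
    orbit n c b w (t + s) i = r * orbit n c b w t i := by
  rw [orbit_add hb, he, orbit_smul]
  rfl

theorem supp_of_eigen (hn : 1 ≤ n) (hs : 0 < s) (hb : ∀ t, b (t + s) = b t) (hc : 1 / 2 ≤ c)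
    (hc1 : c ≤ 1) {w : Fin (n + 1) → ℝ} (hw : 0 ≤ w) {r : ℝ} (hr : 0 < r)
    (he : orbit n c b w s = r • w) : ∀ j ∉ finalClass n b, w j = 0 := by
  have hc0 : 0 ≤ c := by linarith
  rw [supp_finalClass_iff (c := c) hn]
  intro t ht
  exact (orbit_isRun hn w).y_eq_zero_of_not_live hn hs hc hc1
    (fun t => orbit_nonneg hc0 hw t 0) (fun t => orbit_nonneg hc0 hw t _) hr
    (fun t => orbit_add_of_eigen hb he t 0) (fun t => orbit_add_of_eigen hb he t _) ht

theorem sum_orbit (w : Fin (n + 1) → ℝ) (t : ℕ) :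
    ∑ j, orbit n c b w t j
      = mass n (fun t => orbit n c b w t 0) (fun t => orbit n c b w t (Fin.last n)) t := by
  rw [Fin.sum_univ_succ, mass, ← Finset.sum_range_reflect, Finset.sum_range]
  congr 1
  refine Finset.sum_congr rfl fun i _ => ?_
  rw [show n - 1 - i.val = n - (i.val + 1) by omega]
  exact orbit_apply w t (by omega) (by omega)

/-- For `c = 1 / 2` the matrices are column-stochastic, so the mass is constant. -/
theorem eigenvalue_eq_one_of_half (hn : 1 ≤ n) {w : Fin (n + 1) → ℝ} (hw : ∑ j, w j = 1) {r : ℝ}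
    (he : orbit n (1 / 2) b w s = r • w) : r = 1 := by
  have hsum : ∀ t, ∑ j, orbit n (1 / 2) b w t j = 1 := by
    intro t
    induction t with
    | zero => exact hw
    | succ t ih =>
      rw [sum_orbit] at ih ⊢
      rw [(orbit_isRun hn w).mass_succ, ih]
      norm_num
  have h := hsum s
  rw [he] at h
  simpa [← Finset.mul_sum, hw] using h

end Orbits

/-! ### Products along a word -/

section Words

variable {n s : ℕ} {c : ℝ}

/-- The letters `a_{s-1}, …, a_0` repeated periodically: the order in which the factors of
`C_{a_0} ⋯ C_{a_{s-1}}` act on a vector. -/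
def letter (hs : 0 < s) (a : Fin s → Fin 2) (t : ℕ) : Fin 2 :=
  a ⟨s - 1 - t % s, by omega⟩

theorem letter_add (hs : 0 < s) (a : Fin s → Fin 2) (t : ℕ) :
    letter hs a (t + s) = letter hs a t := by
  simp [letter]

/-- The matrix `C_{a_0} ⋯ C_{a_{s-1}}`, whose inverse is conjugate to the product in question. -/
noncomputable def periodMatrix (n : ℕ) (c : ℝ) (a : Fin s → Fin 2) :
    Matrix (Fin (n + 1)) (Fin (n + 1)) ℝ :=
  (List.ofFn fun t => C n c (a t)).prod

theorem orbit_letter (hs : 0 < s) (a : Fin s → Fin 2) (w : Fin (n + 1) → ℝ) :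
    orbit n c (letter hs a) w s = periodMatrix n c a *ᵥ w := by
  have h : ∀ t ≤ s, orbit n c (letter hs a) w t
      = ((List.ofFn fun t => C n c (a t)).drop (s - t)).prod *ᵥ w := by
    intro t
    induction t with
    | zero =>
      intro _
      rw [List.drop_of_length_le (by simp)]
      simp [orbit]
    | succ t ih =>
      intro ht
      have hlt : s - (t + 1) < (List.ofFn fun t => C n c (a t)).length := by
        rw [List.length_ofFn]
        omega
      rw [List.drop_eq_getElem_cons hlt, show s - (t + 1) + 1 = s - t by omega, List.prod_cons,
        ← mulVec_mulVec, ← ih (by omega), List.getElem_ofFn]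
      simp only [orbit, letter]
      congr 3
      ext
      simp only [Nat.mod_eq_of_lt (show t < s by omega)]
      omega
  rw [h s le_rfl, Nat.sub_self, List.drop_zero]
  rfl

theorem prod_mem_of_forall_mem {R : Type*} [Semiring R] {m : Type*} [Fintype m] [DecidableEq m]
    (S : Subsemiring R) (l : List (Matrix m m R)) (h : ∀ N ∈ l, ∀ i j, N i j ∈ S) (i j : m) :
    l.prod i j ∈ S := by
  induction l generalizing i j with
  | nil =>
    rw [List.prod_nil, one_apply]
    split_ifs
    exacts [S.one_mem, S.zero_mem]
  | cons N l ih =>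
    rw [List.prod_cons, mul_apply]
    exact S.sum_mem fun k _ => S.mul_mem (h N (by simp) i k)
      (ih (fun N' hN' => h N' (by simp [hN'])) k j)

theorem periodMatrix_nonneg (hc : 0 ≤ c) (a : Fin s → Fin 2) (i j : Fin (n + 1)) :
    0 ≤ periodMatrix n c a i j := by
  refine prod_mem_of_forall_mem (Subsemiring.nonneg ℝ) _ (fun N hN i j => ?_) i j
  obtain ⟨t, rfl⟩ := List.mem_ofFn.1 hN
  exact C_nonneg hc i j

theorem periodMatrix_mem (F : IntermediateField ℚ ℝ) (hc : c ∈ F) (a : Fin s → Fin 2)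
    (i j : Fin (n + 1)) : periodMatrix n c a i j ∈ F := by
  refine prod_mem_of_forall_mem F.toSubfield.toSubring.toSubsemiring _ (fun N hN i j => ?_) i j
  obtain ⟨t, rfl⟩ := List.mem_ofFn.1 hN
  have hA : A n (a t) i j ∈ F := by
    simp only [A, of_apply]
    split_ifs
    exacts [F.one_mem, F.zero_mem]
  change C n c (a t) i j ∈ F
  simp only [C, of_apply]
  split_ifs
  exacts [F.mul_mem hc hA, hA]

theorem periodMatrix_isUnit (hn : 1 ≤ n) (hc : 0 < c) (a : Fin s → Fin 2) :
    IsUnit (periodMatrix n c a) := by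
  refine Submonoid.list_prod_mem (IsUnit.submonoid _) fun N hN => ?_
  obtain ⟨t, rfl⟩ := List.mem_ofFn.1 hN
  exact C_isUnit hn hc

theorem wordProd_mul (hn : 1 ≤ n) (hc : 0 < c) (a : Fin s → Fin 2) :
    wordProd (fun e => V n * (C n c e)⁻¹ * (V n)⁻¹) a * (V n * periodMatrix n c a) = V n := by
  have hV := (V_isUnit n).map detMonoidHom
  have h : ∀ l : List (Fin 2), (l.map fun e => V n * (C n c e)⁻¹ * (V n)⁻¹).reverse.prod
      * (V n * (l.map (C n c)).prod) = V n := by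
    intro l
    induction l with
    | nil => simp
    | cons e l ih =>
      have hC := (C_isUnit (a := e) hn hc).map detMonoidHom
      have h1 : V n * (C n c e)⁻¹ * (V n)⁻¹ * (V n * (C n c e * (l.map (C n c)).prod))
          = V n * (l.map (C n c)).prod := by
        rw [mul_assoc, nonsing_inv_mul_cancel_left _ _ hV, mul_assoc,
          nonsing_inv_mul_cancel_left _ _ hC]
      rw [List.map_cons, List.map_cons, List.reverse_cons, List.prod_append, List.prod_singleton,
        List.prod_cons, mul_assoc, h1, ih]
  have := h (List.ofFn a)
  rwa [List.map_ofFn, List.map_ofFn] at this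

end Words

/-! ### Barycentric coordinates -/

section Simplex

variable {n s : ℕ} {c : ℝ}

theorem V_last (n : ℕ) (j : Fin (n + 1)) : V n (Fin.last n) j = 1 := by
  simp [V]

theorem V_mulVec_eq_lift_iff {w : Fin (n + 1) → ℝ} {q : Fin n → ℝ} :
    V n *ᵥ w = lift q ↔ ∑ i, w i = 1 ∧ ∀ i : Fin n, (V n *ᵥ w) i.castSucc = q i := by
  have hlast : (V n *ᵥ w) (Fin.last n) = ∑ i, w i := by
    simp [mulVec, dotProduct, V_last]
  constructor
  · intro h
    refine ⟨?_, fun i => ?_⟩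
    · rw [← hlast, h]
      simp [lift]
    · rw [h]
      simp [lift]
  · rintro ⟨h1, h2⟩
    ext i
    refine Fin.lastCases ?_ (fun i => ?_) i
    · rw [hlast, h1]
      simp [lift]
    · rw [h2]
      simp [lift]

/-- The barycentric coordinates of a point of `Δ` are the solution `w` of `V w = (q, 1)`. -/
theorem mem_Delta_iff {q : Fin n → ℝ} :
    q ∈ Delta n ↔ ∃ w ∈ stdSimplex ℝ (Fin (n + 1)), V n *ᵥ w = lift q := by
  let f : (Fin (n + 1) → ℝ) →ₗ[ℝ] (Fin n → ℝ) :=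
    { toFun := fun w i => (V n *ᵥ w) i.castSucc
      map_add' := fun x y => by ext i; simp [mulVec_add]
      map_smul' := fun r x => by ext i; simp [mulVec_smul] }
  have hD : Delta n = f '' stdSimplex ℝ (Fin (n + 1)) := by
    rw [← convexHull_rangle_single_eq_stdSimplex, f.image_convexHull, ← Set.range_comp, Delta]
    congr 2
    ext j i
    simp [f, vertex, V_last]
  rw [hD]
  constructor
  · rintro ⟨w, hw, rfl⟩
    exact ⟨w, hw, V_mulVec_eq_lift_iff.2 ⟨hw.2, fun _ => rfl⟩⟩
  · rintro ⟨w, hw, h⟩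
    exact ⟨w, hw, funext (V_mulVec_eq_lift_iff.1 h).2⟩

theorem isEigenpoint_iff (hn : 1 ≤ n) (hc : 0 < c) (a : Fin s → Fin 2) {ξ : ℝ} (hξ : ξ ≠ 0)
    {q : Fin n → ℝ} {w : Fin (n + 1) → ℝ} (hw : V n *ᵥ w = lift q) :
    IsEigenpoint (wordProd (fun e => V n * (C n c e)⁻¹ * (V n)⁻¹) a) ξ q ↔
      periodMatrix n c a *ᵥ w = ξ⁻¹ • w := by
  set W := wordProd (fun e => V n * (C n c e)⁻¹ * (V n)⁻¹) a with hW
  set P := periodMatrix n c a with hP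
  have hWVP : W * (V n * P) = V n := wordProd_mul hn hc a
  have hVdet := (V_isUnit n).map detMonoidHom
  have hV : Function.Injective (V n).mulVec := mulVec_injective_iff_isUnit.2 (V_isUnit n)
  have hWu : Function.Injective W.mulVec := by
    refine mulVec_injective_iff_isUnit.2 ?_
    have h1 : W * (V n * P * (V n)⁻¹) = 1 := by
      rw [← mul_assoc, hWVP, mul_nonsing_inv _ hVdet]
    exact IsUnit.of_mul_eq_one _ h1
  have hne : lift q ≠ 0 := by
    intro h
    have := congrFun h (Fin.last n)
    simp [lift] at this
  rw [IsEigenpoint, Module.End.hasEigenvector_iff, Module.End.mem_eigenspace_iff, toLin'_apply,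
    and_iff_left hne, ← hw]
  have hkey : V n *ᵥ w = W *ᵥ (V n *ᵥ (P *ᵥ w)) := by
    rw [mulVec_mulVec, mulVec_mulVec, mul_assoc, hWVP]
  constructor
  · intro h
    have h1 : W *ᵥ (V n *ᵥ w) = W *ᵥ (V n *ᵥ (ξ • (P *ᵥ w))) := by
      rw [h, mulVec_smul, mulVec_smul, ← hkey]
    rw [eq_inv_smul_iff₀ hξ]
    exact (hV (hWu h1)).symm
  · intro h
    rw [h, mulVec_smul, mulVec_smul, eq_inv_smul_iff₀ hξ] at hkey
    exact hkey.symm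

end Simplex

/-! ### Eigenpoints in the simplex -/

section Eigenpoints

variable {n s : ℕ} {c : ℝ}

theorem isFinalClass_periodMatrix (hn : 1 ≤ n) (hs : 0 < s) (hc : 0 < c) (a : Fin s → Fin 2) :
    IsFinalClass (periodMatrix n c a) (finalClass n (letter hs a)) :=
  isFinalClass_of_orbit hn hs (letter_add hs a) hc (periodMatrix_nonneg hc.le a)
    (orbit_letter hs a)

theorem exists_eigenvector_of_isEigenpoint (hn : 1 ≤ n) (hs : 0 < s) (hc : 1 / 2 ≤ c)
    (hc1 : c ≤ 1) (a : Fin s → Fin 2) {q : Fin n → ℝ} (hq : q ∈ Delta n) {ξ : ℝ} (hξ : 0 < ξ)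
    (h : IsEigenpoint (wordProd (fun e => V n * (C n c e)⁻¹ * (V n)⁻¹) a) ξ q) :
    ∃ w ∈ stdSimplex ℝ (Fin (n + 1)), V n *ᵥ w = lift q ∧
      (∀ i ∉ finalClass n (letter hs a), w i = 0) ∧ periodMatrix n c a *ᵥ w = ξ⁻¹ • w := by
  obtain ⟨w, hw, hVw⟩ := mem_Delta_iff.1 hq
  have he := (isEigenpoint_iff hn (by linarith) a hξ.ne' hVw).1 h
  refine ⟨w, hw, hVw, ?_, he⟩
  exact supp_of_eigen hn hs (letter_add hs a) hc hc1 hw.1 (inv_pos.2 hξ)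
    ((orbit_letter hs a w).trans he)

theorem existsUnique_eigenpoint (hn : 1 ≤ n) (hs : 0 < s) (hc : 1 / 2 ≤ c) (hc1 : c ≤ 1)
    (a : Fin s → Fin 2) :
    ∃! q : Fin n → ℝ, q ∈ Delta n ∧ ∃ ξ : ℝ, 0 < ξ ∧
      IsEigenpoint (wordProd (fun e => V n * (C n c e)⁻¹ * (V n)⁻¹) a) ξ q := by
  have hc0 : 0 < c := by linarith
  have hF := isFinalClass_periodMatrix hn hs hc0 a
  obtain ⟨w, r, hr, hw, hK, he⟩ := hF.exists_eigenvector
  have hVw : V n *ᵥ w = lift fun i : Fin n => (V n *ᵥ w) i.castSucc :=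
    V_mulVec_eq_lift_iff.2 ⟨hw.2, fun _ => rfl⟩
  refine ⟨_, ⟨mem_Delta_iff.2 ⟨w, hw, hVw⟩, r⁻¹, inv_pos.2 hr, ?_⟩, ?_⟩
  · rw [isEigenpoint_iff hn hc0 a (inv_pos.2 hr).ne' hVw, inv_inv]
    exact he
  · rintro q ⟨hq, ξ, hξ, hqe⟩
    obtain ⟨w', hw', hVw', hK', he'⟩ :=
      exists_eigenvector_of_isEigenpoint hn hs hc hc1 a hq hξ hqe
    have hww := hF.eq_of_eigenvector (inv_pos.2 hξ) hr hw' hw hK' hK he' he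
    subst hww
    exact funext fun i => ((V_mulVec_eq_lift_iff.1 hVw').2 i).symm

theorem V_mem (F : IntermediateField ℚ ℝ) (i j : Fin (n + 1)) : V n i j ∈ F := by
  simp only [V, of_apply]
  split_ifs
  exacts [F.one_mem, F.zero_mem]

/-- Over `ℚ(ξ)` the barycentric coordinates of `q` are the unique solution of a linear system
supported on the final class; over `ℚ(q)` they are the unique solution of `V w = (q, 1)`, and `ξ⁻¹`
is the sum of the entries of `P w`. -/
theorem adjoin_eigenvalue_eq_adjoin_range (hn : 1 ≤ n) (hs : 0 < s) (hc : 1 / 2 ≤ c) (hc1 : c ≤ 1)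
    (hcF : ∀ F : IntermediateField ℚ ℝ, c ∈ F) (a : Fin s → Fin 2) {q : Fin n → ℝ}
    (hq : q ∈ Delta n) {ξ : ℝ} (hξ : 0 < ξ)
    (h : IsEigenpoint (wordProd (fun e => V n * (C n c e)⁻¹ * (V n)⁻¹) a) ξ q) :
    IntermediateField.adjoin ℚ {ξ} = IntermediateField.adjoin ℚ (Set.range q) := by
  have hF := isFinalClass_periodMatrix hn hs (show 0 < c by linarith) a
  obtain ⟨w, hw, hVw, hK, he⟩ := exists_eigenvector_of_isEigenpoint hn hs hc hc1 a hq hξ h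
  apply le_antisymm
  · set F := IntermediateField.adjoin ℚ (Set.range q)
    have hlift : ∀ i, lift q i ∈ F := by
      refine Fin.lastCases ?_ fun i => ?_
      · simp only [lift, Fin.snoc_last]
        exact F.one_mem
      · simp only [lift, Fin.snoc_castSucc]
        exact IntermediateField.subset_adjoin _ _ ⟨i, rfl⟩
    have hwF : ∀ i, w i ∈ F := by
      refine mem_of_forall_retraction F fun π hπ => ?_
      refine mulVec_injective_iff_isUnit.2 (V_isUnit n) ?_
      rw [← retraction_mulVec π (V_mem F), hVw]
      exact funext fun i => congrArg Subtype.val (hπ ⟨lift q i, hlift i⟩)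
    have hξF : ξ⁻¹ ∈ F := by
      have h1 : ξ⁻¹ = ∑ i, (periodMatrix n c a *ᵥ w) i := by
        simp [he, ← Finset.mul_sum, hw.2]
      rw [h1]
      exact sum_mem fun i _ => mulVec_mem F (periodMatrix_mem F (hcF F) a) hwF i
    rw [IntermediateField.adjoin_simple_le_iff]
    simpa using F.inv_mem hξF
  · set F := IntermediateField.adjoin ℚ {ξ}
    have hξF : ξ⁻¹ ∈ F := F.inv_mem (IntermediateField.mem_adjoin_simple_self ℚ ξ)
    have hwF : ∀ i, w i ∈ F := by
      refine mem_of_forall_retraction F fun π hπ => ?_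
      refine hF.eq_of_supp (inv_pos.2 hξ) hw hK he ?_ (fun i hi => by simp [hK i hi]) ?_
      · have h1 := congrArg Subtype.val (hπ 1)
        rw [OneMemClass.coe_one, ← hw.2, map_sum] at h1
        simpa [hw.2] using h1
      · rw [← retraction_mulVec π (periodMatrix_mem F (hcF F) a), he]
        ext i
        have h2 := π.map_smul ⟨ξ⁻¹, hξF⟩ (w i)
        exact congrArg Subtype.val h2
    rw [IntermediateField.adjoin_le_iff]
    rintro _ ⟨i, rfl⟩
    rw [← (V_mulVec_eq_lift_iff.1 hVw).2 i]
    exact mulVec_mem F (V_mem F) hwF _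

end Eigenpoints
end Monkemeyer

theorem mainTheorem8 (n : ℕ) (hn : 1 ≤ n) (s : ℕ) (hs : 0 < s) (a : Fin s → Fin 2) :
    ((∃! q : Fin n → ℝ, q ∈ Monkemeyer.Delta n ∧
        ∃ ξ : ℝ, 0 < ξ ∧ Monkemeyer.IsEigenpoint (Monkemeyer.wordProd (Monkemeyer.M n) a) ξ q) ∧
      (∀ q ∈ Monkemeyer.Delta n, ∀ ξ : ℝ, 0 < ξ →
        Monkemeyer.IsEigenpoint (Monkemeyer.wordProd (Monkemeyer.M n) a) ξ q →
          IntermediateField.adjoin ℚ {ξ} = IntermediateField.adjoin ℚ (Set.range q))) ∧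
    ((∃! q : Fin n → ℝ, q ∈ Monkemeyer.Delta n ∧
        ∃ ξ : ℝ, 0 < ξ ∧ Monkemeyer.IsEigenpoint (Monkemeyer.wordProd (Monkemeyer.T n) a) ξ q) ∧
      (∀ q ∈ Monkemeyer.Delta n, ∀ ξ : ℝ, 0 < ξ →
        Monkemeyer.IsEigenpoint (Monkemeyer.wordProd (Monkemeyer.T n) a) ξ q →
          ξ = 1 ∧ ∀ i : Fin n, ∃ r : ℚ, q i = (r : ℝ))) := by
  open Monkemeyer in
  have hM : M n = fun e => V n * (C n 1 e)⁻¹ * (V n)⁻¹ := by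
    rw [C_one]
    rfl
  have hT : T n = fun e => V n * (C n (1 / 2) e)⁻¹ * (V n)⁻¹ := by
    rw [C_half]
    rfl
  rw [hM, hT]
  refine ⟨⟨existsUnique_eigenpoint hn hs (by norm_num) le_rfl a, fun q hq ξ hξ h => ?_⟩,
    existsUnique_eigenpoint hn hs le_rfl (by norm_num) a, fun q hq ξ hξ h => ?_⟩
  · exact adjoin_eigenvalue_eq_adjoin_range hn hs (by norm_num) le_rfl (fun F => F.one_mem) a hq hξ h
  · obtain ⟨w, hw, hVw, -, he⟩ :=
      exists_eigenvector_of_isEigenpoint hn hs le_rfl (by norm_num) a hq hξ h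
    have hξ1 : ξ = 1 :=
      inv_eq_one.1 (eigenvalue_eq_one_of_half hn hw.2 ((orbit_letter hs a w).trans he))
    refine ⟨hξ1, fun i => ?_⟩
    have hadj := adjoin_eigenvalue_eq_adjoin_range hn hs le_rfl (by norm_num)
      (fun F => one_div (2 : ℝ) ▸ F.inv_mem (ofNat_mem F 2)) a hq hξ h
    have hmem : q i ∈ IntermediateField.adjoin ℚ (Set.range q) :=
      IntermediateField.subset_adjoin _ _ ⟨i, rfl⟩
    rw [← hadj, hξ1, IntermediateField.adjoin_one, IntermediateField.mem_bot] at hmem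
    obtain ⟨r, hr⟩ := hmem
    exact ⟨r, hr.symm⟩
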